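/- Let $\mathcal X$ be a measurable space (for instance $\mathcal X\subset\mathbb R^d$), let $c\ge 0$, $n\ge 1$ be integers, and let $D$ be a probability distribution on $\mathcal X\times\{-1,+1\}^c$. Let $\kappa:\mathcal X\times\mathcal X\to\mathbb R$ be a measurable positive semidefinite symmetric kernel with feature map $\phi:\mathcal X\to\mathbb H$ into a real Hilbert space, $\kappa(x,x')=\langle\phi(x),\phi(x')\rangle$ (for instance the canonical feature map into the reproducing kernel Hilbert space of $\kappa$), and assume $\kappa(x,x)\le r^2$ for all $x\in\mathcal X$, where $r>0$. For $\Lambda\in\mathbb R$ let $$\mathcal F=\Big\{x\mapsto(\langle w_1,\phi(x)\rangle,\dots,\langle w_c,\phi(x)\rangle)\;:\;w_1,\dots,w_c\in\mathbb H,\ \Big(\sum_{j=1}^c\|w_j\|^2\Big)^{1/2}\le\Lambda\Big\}.$$ Put $\mathrm{sgn}(u)=1$ if $u>0$ and $\mathrm{sgn}(u)=-1$ otherwise. Let $\ell:\mathbb R\to\mathbb R$ be a $\rho$-Lipschitz function with $|\ell(u)|\le B$ whenever $|u|\le\Lambda r$ (in particular, any $\rho$-Lipschitz function bounded by $B$ on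 $\mathbb R$), which upper bounds the $0/1$ loss: $[\![\mathrm{sgn}(v)\ne y]\!]\le\ell(yv)$ for all $v\in\mathbb R$ and $y\in\{-1,+1\}$. For $y\in\{-1,+1\}^c$ let $Y^\pm=\{j:y_j=\pm1\}$. For $h\in\{-1,+1\}^c$ and $v\in\mathbb R^c$ define $$L_h^{0/1}(h,y)=\frac1c\sum_{j=1}^c[\![h_j\ne y_j]\!],\qquad L_h(v,y)=\frac1c\sum_{j=1}^c\ell(y_jv_j),\qquad L_r^{0/1}(v,y)=\frac1{|Y^+||Y^-|}\sum_{p\in Y^+}\sum_{q\in Y^-}[\![v_p\le v_q]\!],$$ where $L_r^{0/1}(v,y)=0$ if $Y^+$ or $Y^-$ is empty (and all losses are $0$ if $c=0$). For $f\in\mathcal F$ and a sample $S=((x_i,y_i))_{i=1}^n$ put $$R^r_{0/1}(f)=\mathbb E_{(x,y)\sim D}\,L_r^{0/1}(f(x),y),\qquad R^h_{0/1}(\mathrm{sgn}\circ f)=\mathbb E_{(x,y)\sim D}\,L_h^{0/1}(\mathrm{sgn}(f(x)),y),\qquad \hat R^h_S(f)=\frac1n\sum_{i=1}^nL_h(f(x_i),y_i),$$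 with $\mathrm{sgn}$ applied coordinatewise. Then these expectations are well defined (the integrands are integrable), and for every $\delta>0$, with probability at least $1-\delta$ over an i.i.d. sample $S\sim D^n$, the following holds for all $f\in\mathcal F$ simultaneously: $$R^r_{0/1}(f)\ \le\ c\,R^h_{0/1}(\mathrm{sgn}\circ f)\ \le\ c\,\hat R^h_S(f)+2\sqrt2\,\rho\,c\,\sqrt{\frac{\Lambda^2r^2}{n}}+3Bc\,\sqrt{\frac{\log\frac2\delta}{2n}},$$ where, for $\delta>2$, the last square root is read as $0$. -/

import Mathlib

open MeasureTheory
open scoped RealInnerProductSpace NNReal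

noncomputable section

namespace MultiLabel

/-- Label vectors in `{-1, +1}^c`: the integer units are exactly `1` and `-1`. -/
abbrev Labels (c : ℕ) : Type := Fin c → ℤˣ

/-- The sign convention: `1` for positive reals and `-1` otherwise (in particular at `0`). -/
def sgn (u : ℝ) : ℤˣ := if 0 < u then 1 else -1

/-- The classifier `sgn ∘ f` evaluated on a score vector. -/
def sgnVec {c : ℕ} (v : Fin c → ℝ) : Labels c := fun j => sgn (v j)

/-- Hamming loss of a predicted label vector `h` against the true one `y`. -/
def hammingLoss {c : ℕ} (h y : Labels c) : ℝ :=
  (1 / (c : ℝ)) * ∑ j, if h j ≠ y j then (1 : ℝ) else 0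

/-- Surrogate Hamming loss of a score vector `v`, with base loss `ℓ`. -/
def hammingSurrogate {c : ℕ} (ℓ : ℝ → ℝ) (v : Fin c → ℝ) (y : Labels c) : ℝ :=
  (1 / (c : ℝ)) * ∑ j, ℓ (((y j : ℤ) : ℝ) * v j)

/-- Indices of the relevant labels. -/
def relevant {c : ℕ} (y : Labels c) : Finset (Fin c) := {j | y j = 1}

/-- Indices of the irrelevant labels. -/
def irrelevant {c : ℕ} (y : Labels c) : Finset (Fin c) := {j | y j = -1}

/-- Ranking loss of a score vector `v`. If there is no relevant or no irrelevant label, there is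
no pair to be ranked and the value is `0`. -/
def rankingLoss {c : ℕ} (v : Fin c → ℝ) (y : Labels c) : ℝ :=
  (1 / (((relevant y).card : ℝ) * ((irrelevant y).card : ℝ))) *
    ∑ p ∈ relevant y, ∑ q ∈ irrelevant y, if v p ≤ v q then (1 : ℝ) else 0

/-- The expected risk `E_{(x, y) ∼ D} [L (f x, y)]`. -/
def risk {𝒳 A : Type*} [MeasurableSpace 𝒳] {c : ℕ} (D : Measure (𝒳 × Labels c))
    (L : A → Labels c → ℝ) (f : 𝒳 → A) : ℝ :=
  ∫ z, L (f z.1) z.2 ∂D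

/-- The empirical risk on the sample `S`. -/
def empiricalRisk {𝒳 A : Type*} {c n : ℕ} (S : Fin n → 𝒳 × Labels c)
    (L : A → Labels c → ℝ) (f : 𝒳 → A) : ℝ :=
  (1 / (n : ℝ)) * ∑ i, L (f (S i).1) (S i).2

/-- `φ` is a feature mapping of the kernel `κ` into the Hilbert space `H`. A real kernel has a
feature mapping iff it is symmetric and positive semidefinite; the canonical map
`x ↦ κ (·, x)` into the reproducing kernel Hilbert space of `κ` is a feature mapping. -/
def IsFeatureMap {𝒳 H : Type*} [NormedAddCommGroup H] [InnerProductSpace ℝ H]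
    (κ : 𝒳 → 𝒳 → ℝ) (φ : 𝒳 → H) : Prop :=
  ∀ x x', κ x x' = ⟪φ x, φ x'⟫

/-- The kernel-based hypothesis set: the maps `x ↦ (⟪w_1, φ x⟫, …, ⟪w_c, φ x⟫)` with
`(∑ j, ‖w_j‖ ^ 2) ^ (1 / 2) ≤ Λ`. -/
def hypotheses {𝒳 H : Type*} [NormedAddCommGroup H] [InnerProductSpace ℝ H]
    (c : ℕ) (φ : 𝒳 → H) (Λ : ℝ) : Set (𝒳 → Fin c → ℝ) :=
  {f | ∃ w : Fin c → H, √(∑ j, ‖w j‖ ^ 2) ≤ Λ ∧ f = fun x j => ⟪w j, φ x⟫}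

end MultiLabel

end

namespace MultiLabel

/-! A misranked pair contains a misclassified label, so pointwise the ranking loss is at most the
number of misclassified labels, which is `c` times the Hamming loss. This gives the first inequality
(`rankingLoss_le_natCast_mul_hammingLoss`).

For the second, the surrogate dominates the 0/1 loss, and the joint norm constraint is relaxed to
`‖w j‖ ≤ Λ` for each label, so the problem splits into `c` scalar ones. With `y j` absorbed into the
feature vector, each is about `ℓ` of a linear functional on a ball of radius `Λ`. The gap between
risk and empirical risk is bounded by the expectation over a ghost sample of a supremum; the sum of
these over the labels is `totalDeviation`.

Its mean is bounded by symmetrization, contraction and the second moment of signed sums in a Hilbert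
space (`integral_sampleDeviation_le`). It exceeds its mean by little because replacing one sample
point changes it by at most `c * B` (`measureReal_ge_le_of_boundedDifferences`). Only this one
concentration step is needed, with no passage to an empirical complexity, so the stated constants
leave room. -/

theorem abs_integral_le_of_forall {Z : Type*} [MeasurableSpace Z] (D : Measure Z)
    [IsProbabilityMeasure D] {f : Z → ℝ} {C : ℝ} (hC : ∀ z, |f z| ≤ C) : |∫ z, f z ∂D| ≤ C := by
  simpa using norm_integral_le_of_norm_le_const (μ := D) (f := f) (ae_of_all _ hC)

/-! ### Concentration under bounded differences. -/

/-- The exponential moment bound behind McDiarmid's bounded differences inequality. -/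
theorem integral_exp_le_of_boundedDifferences {Z : Type*} [MeasurableSpace Z] (D : Measure Z)
    [IsProbabilityMeasure D] (b t M : ℝ) (n : ℕ) (F : (Fin n → Z) → ℝ) (hF : Measurable F)
    (hM : ∀ S, |F S| ≤ M) (hb : ∀ S i z, |F (Function.update S i z) - F S| ≤ b) :
    ∫ S, Real.exp (t * (F S - ∫ S', F S' ∂Measure.pi fun _ => D)) ∂(Measure.pi fun _ => D)
      ≤ Real.exp (n * b ^ 2 * t ^ 2 / 2) := by
  induction n with
  | zero =>
    have h : F = fun _ => F Fin.elim0 := funext fun S => congrArg F (Subsingleton.elim _ _)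
    rw [h]
    simp
  | succ n ih =>
    have hcons : Measurable fun p : Z × (Fin n → Z) => (Fin.cons p.1 p.2 : Fin (n + 1) → Z) := by
      refine measurable_pi_lambda _ fun i => ?_
      refine Fin.cases ?_ (fun i => ?_) i
      · simpa using measurable_fst
      · simp only [Fin.cons_succ]
        exact (measurable_pi_apply i).comp measurable_snd
    have hmp := (measurePreserving_piFinSuccAbove (fun _ : Fin (n + 1) => D) 0).symm
    have hint (f : (Fin (n + 1) → Z) → ℝ) (hf : Measurable f) (C : ℝ) (hC : ∀ S, |f S| ≤ C) :
        ∫ S, f S ∂(Measure.pi fun _ => D)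
          = ∫ S, ∫ z, f (Fin.cons z S) ∂D ∂(Measure.pi fun _ : Fin n => D) := by
      rw [← hmp.integral_comp']
      rw [← integral_prod_symm (fun p : Z × (Fin n → Z) => f (Fin.cons p.1 p.2))]
      · congr 1
        ext p
        congr 1
        simp [MeasurableEquiv.piFinSuccAbove, Fin.insertNthEquiv]
      · exact Integrable.of_bound (hf.comp hcons).aestronglyMeasurable C
          (ae_of_all _ fun p => hC _)
    -- Averaging out the first coordinate preserves measurability, the bound `M` and the differences
    -- `b`, so the induction hypothesis applies to `G`.
    set G : (Fin n → Z) → ℝ := fun S => ∫ z, F (Fin.cons z S) ∂D with hG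
    have hFc : Measurable fun p : Z × (Fin n → Z) => F (Fin.cons p.1 p.2) := hF.comp hcons
    have hFz (S : Fin n → Z) : Measurable fun z => F (Fin.cons z S) :=
      hFc.comp (measurable_id.prodMk measurable_const)
    have hFi (S : Fin n → Z) : Integrable (fun z => F (Fin.cons z S)) D :=
      Integrable.of_bound (hFz S).aestronglyMeasurable M (ae_of_all _ fun z => hM _)
    have hGm : Measurable G :=
      (hFc.stronglyMeasurable.integral_prod_left (μ := D)).measurable
    have hGM (S) : |G S| ≤ M := abs_integral_le_of_forall D fun z => hM _
    have hGb (S i z) : |G (Function.update S i z) - G S| ≤ b := by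
      rw [hG]
      simp only
      rw [← integral_sub (hFi _) (hFi _)]
      refine abs_integral_le_of_forall D fun z' => ?_
      rw [Fin.cons_update]
      exact hb _ _ _
    have hFG : ∫ S', F S' ∂(Measure.pi fun _ => D) = ∫ S', G S' ∂(Measure.pi fun _ => D) :=
      hint F hF M hM
    set m := ∫ S', G S' ∂(Measure.pi fun _ : Fin n => D) with hm
    have hexp (x : ℝ) (K : ℝ) (hx : |x| ≤ K) : |Real.exp (t * x)| ≤ Real.exp (|t| * K) := by
      rw [Real.abs_exp]
      refine Real.exp_le_exp.2 ((le_abs_self _).trans ?_)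
      rw [abs_mul]
      gcongr
    have hmM : |m| ≤ M := abs_integral_le_of_forall _ hGM
    have hsub (x : ℝ) (hx : |x| ≤ M) : |x - m| ≤ 2 * M := (abs_sub _ _).trans (by linarith)
    rw [hFG, hint _ (by fun_prop) (Real.exp (|t| * (2 * M)))
      (fun S => hexp _ _ (hsub _ (hM S)))]
    have hinner (S : Fin n → Z) : ∫ z, Real.exp (t * (F (Fin.cons z S) - m)) ∂D
        ≤ Real.exp (t * (G S - m)) * Real.exp (b ^ 2 * t ^ 2 / 2) := by
      have z0 : Z := (nonempty_of_isProbabilityMeasure D).some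
      -- Hoeffding's lemma on an interval of length `2 * b` around a reference value gives the
      -- parameter `b ^ 2`; the infimum and supremum as endpoints would give `b ^ 2 / 4`.
      have hsg := ProbabilityTheory.hasSubgaussianMGF_of_mem_Icc (μ := D)
        (X := fun z => F (Fin.cons z S)) (a := F (Fin.cons z0 S) - b) (b := F (Fin.cons z0 S) + b)
        (hFz S).aemeasurable (ae_of_all _ fun z => by
          have := hb (Fin.cons z0 S) 0 z
          rw [Fin.update_cons_zero, abs_le] at this
          constructor <;> linarith)
      have h1 := hsg.mgf_le t
      have h2 : ((((‖F (Fin.cons z0 S) + b - (F (Fin.cons z0 S) - b)‖₊ / 2) ^ 2 : ℝ≥0)) : ℝ)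
          = b ^ 2 := by
        push_cast
        rw [Real.norm_eq_abs, div_pow, sq_abs]
        ring
      rw [h2] at h1
      have h3 : ∫ z, Real.exp (t * (F (Fin.cons z S) - m)) ∂D = Real.exp (t * (G S - m)) *
          ∫ z, Real.exp (t * (F (Fin.cons z S) - G S)) ∂D := by
        rw [← integral_const_mul]
        congr 1
        ext z
        rw [← Real.exp_add]
        ring_nf
      rw [h3]
      exact mul_le_mul_of_nonneg_left h1 (Real.exp_pos _).le
    have hi1 : Integrable (fun S => Real.exp (t * (G S - m)) * Real.exp (b ^ 2 * t ^ 2 / 2))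
        (Measure.pi fun _ : Fin n => D) := by
      refine Integrable.mul_const ?_ _
      exact Integrable.of_bound (by fun_prop) (Real.exp (|t| * (2 * M)))
        (ae_of_all _ fun S => hexp _ _ (hsub _ (hGM S)))
    refine (integral_mono_of_nonneg (ae_of_all _ fun S => integral_nonneg fun z =>
      (Real.exp_pos _).le) hi1 (ae_of_all _ hinner)).trans ?_
    rw [integral_mul_const]
    refine (mul_le_mul_of_nonneg_right (ih G hGm hGM hGb) (Real.exp_pos _).le).trans ?_
    rw [← Real.exp_add]
    refine le_of_eq ?_
    push_cast
    ring_nf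

/-- A bounded differences inequality, with a constant that is not optimal. -/
theorem measureReal_ge_le_of_boundedDifferences {Z : Type*} [MeasurableSpace Z] (D : Measure Z)
    [IsProbabilityMeasure D] {b M : ℝ} (n : ℕ) (F : (Fin n → Z) → ℝ) (hF : Measurable F)
    (hM : ∀ S, |F S| ≤ M) (hb : ∀ S i z, |F (Function.update S i z) - F S| ≤ b)
    {ε : ℝ} (hε : 0 ≤ ε) :
    (Measure.pi fun _ : Fin n => D).real {S | ε ≤ F S - ∫ S', F S' ∂Measure.pi fun _ => D}
      ≤ Real.exp (-ε ^ 2 / (2 * (n * b ^ 2))) := by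
  have hsg : ProbabilityTheory.HasSubgaussianMGF
      (fun S => F S - ∫ S', F S' ∂Measure.pi fun _ => D) (n * ‖b‖₊ ^ 2)
      (Measure.pi fun _ : Fin n => D) := by
    constructor
    · intro t
      have hmM : |∫ S', F S' ∂Measure.pi fun _ : Fin n => D| ≤ M :=
        abs_integral_le_of_forall _ hM
      refine Integrable.of_bound (by fun_prop) (Real.exp (|t| * (2 * M))) (ae_of_all _ fun S => ?_)
      rw [Real.norm_eq_abs, Real.abs_exp]
      refine Real.exp_le_exp.2 ((le_abs_self _).trans ?_)
      rw [abs_mul]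
      gcongr
      refine (abs_sub _ _).trans ?_
      linarith [hM S]
    · intro t
      have := integral_exp_le_of_boundedDifferences D b t M n F hF hM hb
      simpa [ProbabilityTheory.mgf] using this
  simpa using hsg.measure_ge_le hε

/-! ### Sums over signs: contraction and Hilbert space bounds. -/

theorem sum_signs_succ {n : ℕ} (f : (Fin (n + 1) → ℤˣ) → ℝ) :
    ∑ ε, f ε = ∑ ε : Fin n → ℤˣ, (f (Fin.cons 1 ε) + f (Fin.cons (-1) ε)) := by
  rw [← (Fin.consEquiv fun _ : Fin (n + 1) => ℤˣ).sum_comp, Fintype.sum_prod_type_right]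
  refine Finset.sum_congr rfl fun ε _ => ?_
  rw [show (Finset.univ : Finset ℤˣ) = {1, -1} from rfl, Finset.sum_pair (by decide)]
  rfl

/-- For `t` in the first supremum and `t'` in the second, `g t - g t'` is at most `s t - s t'` or `s
t' - s t`. In the second case the roles of `t` and `t'` are exchanged on the right. Boundedness
keeps the suprema from taking their default value. -/
theorem iSup_add_iSup_sub_le {T : Type*} [Nonempty T] (a g s : T → ℝ)
    (hg : ∀ t t', |g t - g t'| ≤ |s t - s t'|) (ha : ∃ C, ∀ t, |a t| ≤ C)
    (hs : ∃ C, ∀ t, |s t| ≤ C) :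
    (⨆ t, (a t + g t)) + (⨆ t, (a t - g t)) ≤ (⨆ t, (a t + s t)) + ⨆ t, (a t - s t) := by
  obtain ⟨C, hC⟩ := ha
  obtain ⟨K, hK⟩ := hs
  have hb1 : BddAbove (Set.range fun t => a t + s t) := by
    refine ⟨C + K, ?_⟩
    rintro _ ⟨t, rfl⟩
    linarith [le_of_abs_le (hC t), le_of_abs_le (hK t)]
  have hb2 : BddAbove (Set.range fun t => a t - s t) := by
    refine ⟨C + K, ?_⟩
    rintro _ ⟨t, rfl⟩
    linarith [le_of_abs_le (hC t), neg_le_of_abs_le (hK t)]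
  refine ciSup_add_ciSup_le fun t t' => ?_
  have h := (le_abs_self _).trans (hg t t')
  have h1 := le_ciSup hb1 t
  have h2 := le_ciSup hb2 t'
  have h3 := le_ciSup hb1 t'
  have h4 := le_ciSup hb2 t
  rcases abs_cases (s t - s t') with ⟨h', _⟩ | ⟨h', _⟩ <;> linarith

/-- The contraction principle for sign sums, without absolute values. -/
theorem sum_signs_iSup_le_of_contraction {T : Type*} [Nonempty T] (n : ℕ) (g s : Fin n → T → ℝ)
    (hg : ∀ i t t', |g i t - g i t'| ≤ |s i t - s i t'|) (hs : ∀ i, ∃ C, ∀ t, |s i t| ≤ C)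
    (a : T → ℝ) (ha : ∃ C, ∀ t, |a t| ≤ C) :
    ∑ ε : Fin n → ℤˣ, ⨆ t, (a t + ∑ i, ((ε i : ℤ) : ℝ) * g i t)
      ≤ ∑ ε : Fin n → ℤˣ, ⨆ t, (a t + ∑ i, ((ε i : ℤ) : ℝ) * s i t) := by
  induction n generalizing a with
  | zero => simp
  | succ n ih =>
    have hg0 : ∃ C, ∀ t, |g 0 t| ≤ C := by
      obtain ⟨C, hC⟩ := hs 0
      obtain ⟨t0⟩ := ‹Nonempty T›
      refine ⟨|g 0 t0| + 2 * C, fun t => ?_⟩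
      have h1 := hg 0 t t0
      have h2 := abs_sub (s 0 t) (s 0 t0)
      have h3 := abs_sub_abs_le_abs_sub (g 0 t) (g 0 t0)
      linarith [hC t, hC t0]
    obtain ⟨C, hC⟩ := ha
    obtain ⟨K, hK⟩ := hg0
    -- Both signs of `g 0` move into the offset `a`, so the induction hypothesis replaces the later
    -- `g i` by `s i`; `hpair` then replaces `g 0`.
    have ih1 := ih (fun i => g i.succ) (fun i => s i.succ) (fun i => hg _) (fun i => hs _)
      (fun t => a t + g 0 t) ⟨C + K, fun t => (abs_add_le _ _).trans (add_le_add (hC t) (hK t))⟩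
    have ih2 := ih (fun i => g i.succ) (fun i => s i.succ) (fun i => hg _) (fun i => hs _)
      (fun t => a t - g 0 t) ⟨C + K, fun t => (abs_sub _ _).trans (add_le_add (hC t) (hK t))⟩
    have hpair (ε : Fin n → ℤˣ) := iSup_add_iSup_sub_le
      (fun t => a t + ∑ i, ((ε i : ℤ) : ℝ) * s i.succ t) (g 0) (s 0) (hg 0)
      (by
        choose K' hK' using fun i : Fin n => hs i.succ
        refine ⟨C + ∑ i, K' i, fun t => (abs_add_le _ _).trans (add_le_add (hC t) ?_)⟩
        refine (Finset.abs_sum_le_sum_abs _ _).trans (Finset.sum_le_sum fun i _ => ?_)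
        rcases Int.units_eq_one_or (ε i) with h | h <;> simpa [h] using hK' i t) (hs 0)
    rw [sum_signs_succ, sum_signs_succ]
    simp only [Fin.sum_univ_succ, Fin.cons_zero, Fin.cons_succ, Units.val_one, Units.val_neg,
      Int.cast_one, Int.cast_neg, one_mul, neg_mul]
    calc _ = (∑ ε : Fin n → ℤˣ, ⨆ t, (a t + g 0 t + ∑ i, ((ε i : ℤ) : ℝ) * g i.succ t))
          + ∑ ε : Fin n → ℤˣ, ⨆ t, (a t - g 0 t + ∑ i, ((ε i : ℤ) : ℝ) * g i.succ t) := by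
          rw [← Finset.sum_add_distrib]
          simp only [← add_assoc, ← sub_eq_add_neg]
      _ ≤ _ := add_le_add ih1 ih2
      _ = ∑ ε : Fin n → ℤˣ, ((⨆ t, (a t + ∑ i, ((ε i : ℤ) : ℝ) * s i.succ t + g 0 t))
          + ⨆ t, (a t + ∑ i, ((ε i : ℤ) : ℝ) * s i.succ t - g 0 t)) := by
          rw [← Finset.sum_add_distrib]
          simp only [add_right_comm, sub_add_eq_add_sub]
      _ ≤ _ := Finset.sum_le_sum fun ε _ => hpair ε
      _ = _ := by
          simp only [add_right_comm, ← sub_add_eq_add_sub, ← add_assoc, ← sub_eq_add_neg]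

section InnerProductSpace

variable {H : Type*} [NormedAddCommGroup H] [InnerProductSpace ℝ H]

/-- Cross terms cancel over the signs; the offset `u` lets each induction step be one parallelogram
law. -/
theorem sum_signs_norm_add_sq (n : ℕ) (v : Fin n → H) (u : H) :
    ∑ ε : Fin n → ℤˣ, ‖u + ∑ i, ((ε i : ℤ) : ℝ) • v i‖ ^ 2
      = 2 ^ n * (‖u‖ ^ 2 + ∑ i, ‖v i‖ ^ 2) := by
  induction n generalizing u with
  | zero => simp
  | succ n ih =>
    have h1 := ih (fun i => v i.succ) (u + v 0)
    have h2 := ih (fun i => v i.succ) (u - v 0)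
    have h3 := parallelogram_law_with_norm ℝ u (v 0)
    rw [sum_signs_succ]
    simp only [Fin.sum_univ_succ, Fin.cons_zero, Fin.cons_succ, Units.val_one, Units.val_neg,
      Int.cast_one, Int.cast_neg, one_smul, neg_smul, ← add_assoc, ← sub_eq_add_neg,
      Finset.sum_add_distrib]
    rw [h1, h2, pow_succ]
    linear_combination (2 : ℝ) ^ n * h3

/-- Cauchy–Schwarz over the `2 ^ n` sign vectors reduces this to the second moment. -/
theorem sum_signs_norm_le (n : ℕ) (v : Fin n → H) {r : ℝ} (hv : ∀ i, ‖v i‖ ≤ r) (hr : 0 ≤ r) :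
    ∑ ε : Fin n → ℤˣ, ‖∑ i, ((ε i : ℤ) : ℝ) • v i‖ ≤ 2 ^ n * (r * √n) := by
  have h1 := sum_signs_norm_add_sq n v 0
  simp only [zero_add, norm_zero, ne_eq, OfNat.ofNat_ne_zero, not_false_eq_true, zero_pow] at h1
  have h2 : ∑ i, ‖v i‖ ^ 2 ≤ n * r ^ 2 := by
    refine (Finset.sum_le_sum fun i _ => pow_le_pow_left₀ (norm_nonneg _) (hv i) 2).trans ?_
    simp
  have h3 := sq_sum_le_card_mul_sum_sq (s := (Finset.univ : Finset (Fin n → ℤˣ)))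
    (f := fun ε => ‖∑ i, ((ε i : ℤ) : ℝ) • v i‖)
  have hcard : (((Finset.univ : Finset (Fin n → ℤˣ)).card : ℕ) : ℝ) = 2 ^ n := by
    simp [Finset.card_univ, Fintype.card_units_int]
  rw [hcard, h1] at h3
  refine abs_le_of_sq_le_sq' (h3.trans ?_) (by positivity) |>.2
  rw [mul_pow, mul_pow, Real.sq_sqrt (Nat.cast_nonneg n), pow_two ((2 : ℝ) ^ n), mul_assoc]
  gcongr
  linarith

/-- The Rademacher complexity of a Lipschitz image of a ball of linear functionals. -/
theorem sum_signs_iSup_closedBall_le (n : ℕ) (v : Fin n → H) {r Λ : ℝ} (hv : ∀ i, ‖v i‖ ≤ r)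
    (hr : 0 ≤ r) (hΛ : 0 ≤ Λ) (g : Fin n → ℝ → ℝ) {ρ : ℝ≥0} (hg : ∀ i, LipschitzWith ρ (g i)) :
    ∑ ε : Fin n → ℤˣ, ⨆ w : Metric.closedBall (0 : H) Λ, ∑ i, ((ε i : ℤ) : ℝ) * g i ⟪(w : H), v i⟫
      ≤ 2 ^ n * (ρ * Λ * r * √n) := by
  have : Nonempty (Metric.closedBall (0 : H) Λ) := ⟨⟨0, by simpa⟩⟩
  have h1 := sum_signs_iSup_le_of_contraction n
    (fun i (w : Metric.closedBall (0 : H) Λ) => g i ⟪(w : H), v i⟫) (fun i w => ρ * ⟪(w : H), v i⟫)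
    (fun i w w' => by
      have := (hg i).dist_le_mul ⟪(w : H), v i⟫ ⟪(w' : H), v i⟫
      rw [Real.dist_eq, Real.dist_eq] at this
      rwa [← mul_sub, abs_mul, NNReal.abs_eq])
    (fun i => ⟨ρ * (Λ * ‖v i‖), fun w => by
      rw [abs_mul, NNReal.abs_eq]
      gcongr
      refine (abs_real_inner_le_norm _ _).trans ?_
      gcongr
      exact mem_closedBall_zero_iff.1 w.2⟩)
    (fun _ => 0) ⟨0, by simp⟩
  simp only [zero_add] at h1
  refine h1.trans ?_
  have h2 (ε : Fin n → ℤˣ) : (⨆ w : Metric.closedBall (0 : H) Λ,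
      ∑ i, ((ε i : ℤ) : ℝ) * (ρ * ⟪(w : H), v i⟫)) ≤ ρ * Λ * ‖∑ i, ((ε i : ℤ) : ℝ) • v i‖ := by
    refine ciSup_le fun w => ?_
    have : ∑ i, ((ε i : ℤ) : ℝ) * (ρ * ⟪(w : H), v i⟫)
        = ρ * ⟪(w : H), ∑ i, ((ε i : ℤ) : ℝ) • v i⟫ := by
      simp only [inner_sum, inner_smul_right, Finset.mul_sum]
      exact Finset.sum_congr rfl fun i _ => by ring
    rw [this, mul_assoc]
    gcongr
    refine (real_inner_le_norm _ _).trans ?_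
    gcongr
    exact mem_closedBall_zero_iff.1 w.2
  refine (Finset.sum_le_sum fun ε _ => h2 ε).trans ?_
  rw [← Finset.mul_sum]
  refine (mul_le_mul_of_nonneg_left (sum_signs_norm_le n v hv hr) (by positivity)).trans ?_
  exact le_of_eq (by ring)

end InnerProductSpace

/-! ### Deviation between two samples for one scalar output. -/

section FeatureMap

variable {Z : Type*} {H : Type*} [NormedAddCommGroup H] [InnerProductSpace ℝ H]

/-- The largest difference, over linear functionals in a ball, of the summed losses on two
samples. -/
noncomputable def sampleDeviation (ℓ : ℝ → ℝ) (φ : Z → H) (Λ : ℝ) {n : ℕ} (S S' : Fin n → Z) : ℝ :=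
  ⨆ w : Metric.closedBall (0 : H) Λ, ∑ i, (ℓ ⟪(w : H), φ (S' i)⟫ - ℓ ⟪(w : H), φ (S i)⟫)

variable {φ : Z → H} {Λ r B : ℝ} {ℓ : ℝ → ℝ} {n : ℕ}

theorem loss_mem_Icc (hr : ∀ z, ‖φ z‖ ≤ r) (hB : ∀ u, |u| ≤ Λ * r → ℓ u ∈ Set.Icc 0 B)
    (w : Metric.closedBall (0 : H) Λ) (z : Z) : ℓ ⟪(w : H), φ z⟫ ∈ Set.Icc 0 B := by
  have hw := mem_closedBall_zero_iff.1 w.2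
  refine hB _ ((abs_real_inner_le_norm _ _).trans ?_)
  exact mul_le_mul hw (hr z) (norm_nonneg _) ((norm_nonneg _).trans hw)

theorem abs_loss_sub_loss_le (hr : ∀ z, ‖φ z‖ ≤ r) (hB : ∀ u, |u| ≤ Λ * r → ℓ u ∈ Set.Icc 0 B)
    (w : Metric.closedBall (0 : H) Λ) (z z' : Z) :
    |ℓ ⟪(w : H), φ z'⟫ - ℓ ⟪(w : H), φ z⟫| ≤ B := by
  have h1 := loss_mem_Icc hr hB w z
  have h2 := loss_mem_Icc hr hB w z'
  rw [abs_le]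
  constructor <;> linarith [h1.1, h1.2, h2.1, h2.2]

theorem abs_sum_loss_sub_loss_le (hr : ∀ z, ‖φ z‖ ≤ r)
    (hB : ∀ u, |u| ≤ Λ * r → ℓ u ∈ Set.Icc 0 B) (S S' : Fin n → Z)
    (w : Metric.closedBall (0 : H) Λ) :
    |∑ i, (ℓ ⟪(w : H), φ (S' i)⟫ - ℓ ⟪(w : H), φ (S i)⟫)| ≤ n * B := by
  refine (Finset.abs_sum_le_sum_abs _ _).trans ?_
  refine (Finset.sum_le_sum fun i _ => abs_loss_sub_loss_le hr hB w (S i) (S' i)).trans ?_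
  simp

theorem bddAbove_sum_loss_sub_loss (hr : ∀ z, ‖φ z‖ ≤ r)
    (hB : ∀ u, |u| ≤ Λ * r → ℓ u ∈ Set.Icc 0 B) (S S' : Fin n → Z) :
    BddAbove (Set.range fun w : Metric.closedBall (0 : H) Λ =>
      ∑ i, (ℓ ⟪(w : H), φ (S' i)⟫ - ℓ ⟪(w : H), φ (S i)⟫)) := by
  refine ⟨n * B, ?_⟩
  rintro _ ⟨w, rfl⟩
  exact le_of_abs_le (abs_sum_loss_sub_loss_le hr hB S S' w)

theorem abs_sampleDeviation_le (hΛ : 0 ≤ Λ) (hr : ∀ z, ‖φ z‖ ≤ r)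
    (hB : ∀ u, |u| ≤ Λ * r → ℓ u ∈ Set.Icc 0 B) (S S' : Fin n → Z) :
    |sampleDeviation ℓ φ Λ S S'| ≤ n * B := by
  have : Nonempty (Metric.closedBall (0 : H) Λ) := ⟨⟨0, by simpa⟩⟩
  have h := abs_sum_loss_sub_loss_le hr hB S S'
  refine abs_le.2 ⟨?_, ciSup_le fun w => le_of_abs_le (h w)⟩
  exact (neg_le_of_abs_le (h ⟨0, by simpa⟩)).trans
    (le_ciSup (bddAbove_sum_loss_sub_loss hr hB S S') ⟨0, by simpa⟩)

/-- For each `w` only the `i`-th term changes, by a difference of two values in `[0, B]`. -/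
theorem abs_sampleDeviation_update_sub_le (hΛ : 0 ≤ Λ) (hr : ∀ z, ‖φ z‖ ≤ r)
    (hB : ∀ u, |u| ≤ Λ * r → ℓ u ∈ Set.Icc 0 B) (S S' : Fin n → Z) (i : Fin n) (z : Z) :
    |sampleDeviation ℓ φ Λ (Function.update S i z) S' - sampleDeviation ℓ φ Λ S S'| ≤ B := by
  have : Nonempty (Metric.closedBall (0 : H) Λ) := ⟨⟨0, by simpa⟩⟩
  have key (S₁ S₂ : Fin n → Z) (h : ∀ k, k ≠ i → S₁ k = S₂ k) :
      sampleDeviation ℓ φ Λ S₁ S' ≤ sampleDeviation ℓ φ Λ S₂ S' + B := by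
    refine ciSup_le fun w => ?_
    have h1 := le_ciSup (bddAbove_sum_loss_sub_loss hr hB S₂ S') w
    have h2 : ∑ k, (ℓ ⟪(w : H), φ (S' k)⟫ - ℓ ⟪(w : H), φ (S₁ k)⟫)
        - ∑ k, (ℓ ⟪(w : H), φ (S' k)⟫ - ℓ ⟪(w : H), φ (S₂ k)⟫)
        = ℓ ⟪(w : H), φ (S₂ i)⟫ - ℓ ⟪(w : H), φ (S₁ i)⟫ := by
      rw [← Finset.sum_sub_distrib, Finset.sum_eq_single i]
      · ring
      · intro k _ hk
        rw [h k hk]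
        ring
      · simp
    have h3 := le_of_abs_le (abs_loss_sub_loss_le hr hB w (S₁ i) (S₂ i))
    unfold sampleDeviation
    linarith
  have h1 := key (Function.update S i z) S fun k hk => Function.update_of_ne hk _ _
  have h2 := key S (Function.update S i z) fun k hk => (Function.update_of_ne hk _ _).symm
  rw [abs_le]
  constructor <;> linarith

/-- The sign flip of a pair: the identity or the exchange of the components. -/
def swapBy (ε : ℤˣ) (q : Z × Z) : Z × Z := if ε = 1 then q else q.swap

/-- Exchanging a pair multiplies its loss difference by `ε i`. Splitting the supremum into one for
`ℓ` and one for `-ℓ` leaves two Rademacher sums, whence the factor `2`. -/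
theorem sum_signs_sampleDeviation_le (hΛ : 0 ≤ Λ) (hr0 : 0 ≤ r) (hr : ∀ z, ‖φ z‖ ≤ r)
    {ρ : ℝ≥0} (hℓ : LipschitzWith ρ ℓ) (hB : ∀ u, |u| ≤ Λ * r → ℓ u ∈ Set.Icc 0 B)
    (q : Fin n → Z × Z) :
    ∑ ε : Fin n → ℤˣ, sampleDeviation ℓ φ Λ (fun i => (swapBy (ε i) (q i)).1)
      (fun i => (swapBy (ε i) (q i)).2) ≤ 2 ^ n * (2 * (ρ * Λ * r * √n)) := by
  have : Nonempty (Metric.closedBall (0 : H) Λ) := ⟨⟨0, by simpa⟩⟩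
  have hb (g : ℝ → ℝ) (hg : ∀ u, |u| ≤ Λ * r → |g u| ≤ B) (ε : Fin n → ℤˣ) (S : Fin n → Z) :
      BddAbove (Set.range fun w : Metric.closedBall (0 : H) Λ =>
        ∑ i, ((ε i : ℤ) : ℝ) * g ⟪(w : H), φ (S i)⟫) := by
    refine ⟨∑ _i : Fin n, B, ?_⟩
    rintro _ ⟨w, rfl⟩
    refine Finset.sum_le_sum fun i _ => (le_abs_self _).trans ?_
    have hw := mem_closedBall_zero_iff.1 w.2
    have hg' := hg ⟪(w : H), φ (S i)⟫ ((abs_real_inner_le_norm _ _).trans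
      (mul_le_mul hw (hr _) (norm_nonneg _) ((norm_nonneg _).trans hw)))
    rcases Int.units_eq_one_or (ε i) with h | h <;> simpa [h] using hg'
  have hℓB : ∀ u, |u| ≤ Λ * r → |ℓ u| ≤ B := fun u hu => by
    rw [abs_of_nonneg (hB u hu).1]; exact (hB u hu).2
  have hpt (ε : Fin n → ℤˣ) : sampleDeviation ℓ φ Λ (fun i => (swapBy (ε i) (q i)).1)
      (fun i => (swapBy (ε i) (q i)).2)
      ≤ (⨆ w : Metric.closedBall (0 : H) Λ, ∑ i, ((ε i : ℤ) : ℝ) * ℓ ⟪(w : H), φ (q i).2⟫)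
        + ⨆ w : Metric.closedBall (0 : H) Λ,
          ∑ i, ((ε i : ℤ) : ℝ) * (fun u => -ℓ u) ⟪(w : H), φ (q i).1⟫ := by
    refine ciSup_le fun w => ?_
    refine le_trans (le_of_eq ?_) (add_le_add
      (le_ciSup (hb ℓ hℓB ε fun i => (q i).2) w)
      (le_ciSup (hb (fun u => -ℓ u) (by simpa using hℓB) ε fun i => (q i).1) w))
    simp only
    rw [← Finset.sum_add_distrib]
    refine Finset.sum_congr rfl fun i _ => ?_
    rcases Int.units_eq_one_or (ε i) with h | h
    · simp [h, swapBy, sub_eq_add_neg]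
    · simp [h, swapBy, sub_eq_add_neg, add_comm]
  refine (Finset.sum_le_sum fun ε _ => hpt ε).trans ?_
  rw [Finset.sum_add_distrib]
  have h1 := sum_signs_iSup_closedBall_le n (fun i => φ (q i).2) (fun i => hr _) hr0 hΛ
    (fun _ => ℓ) (fun _ => hℓ)
  have h2 := sum_signs_iSup_closedBall_le n (fun i => φ (q i).1) (fun i => hr _) hr0 hΛ
    (fun _ u => -ℓ u) (fun _ => hℓ.neg)
  linarith

/-! ### Measurability from that of the kernel alone. -/

variable [MeasurableSpace Z]

/-- A linear functional of a feature map with measurable kernel is measurable, even if the feature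
map itself is not. -/
theorem measurable_inner_featureMap [CompleteSpace H]
    (hφ : Measurable fun p : Z × Z => ⟪φ p.1, φ p.2⟫) (w : H) :
    Measurable fun z => ⟪w, φ z⟫ := by
  -- Only the projection of `w` onto the closed span of the features matters. It is a limit of
  -- finite combinations of features, whose functionals are combinations of kernel sections.
  set K := (Submodule.span ℝ (Set.range φ)).topologicalClosure
  have : CompleteSpace K := (Submodule.isClosed_topologicalClosure _).completeSpace_coe
  have hspan : ∀ u ∈ Submodule.span ℝ (Set.range φ), Measurable fun z => ⟪u, φ z⟫ := by
    intro u hu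
    induction hu using Submodule.span_induction with
    | mem x hx =>
      obtain ⟨z0, rfl⟩ := hx
      exact hφ.comp (measurable_const.prodMk measurable_id)
    | zero => simp
    | add x y _ _ hx hy =>
      simp only [inner_add_left]
      exact hx.add hy
    | smul a x _ hx =>
      simp only [inner_smul_left]
      exact hx.const_mul _
  have hproj : ∀ z, ⟪w, φ z⟫ = ⟪((K.orthogonalProjectionOnto w : K) : H), φ z⟫ := by
    intro z
    have hz : φ z ∈ K := subset_closure (Submodule.subset_span ⟨z, rfl⟩)
    have := K.starProjection_inner_eq_zero w (φ z) hz
    rw [inner_sub_left, sub_eq_zero] at this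
    exact this
  simp only [hproj]
  obtain ⟨u, hu, hlim⟩ := mem_closure_iff_seq_limit.1 (K.orthogonalProjectionOnto w).2
  refine measurable_of_tendsto_metrizable (fun k => hspan (u k) (hu k)) ?_
  rw [tendsto_pi_nhds]
  exact fun z => hlim.inner tendsto_const_nhds

/-- The supremum over a ball can be taken over countably many (clipped) combinations of the
features of the sample points. -/
theorem measurable_iSup_closedBall {ι : Type*} [Fintype ι]
    (hφ : Measurable fun p : Z × Z => ⟪φ p.1, φ p.2⟫) (hΛ : 0 ≤ Λ)
    (hr : ∀ z, ‖φ z‖ ≤ r) (hℓ : Continuous ℓ) (hB : ∀ u, |u| ≤ Λ * r → |ℓ u| ≤ B)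
    (a : ι → ℝ) :
    Measurable fun p : ι → Z =>
      ⨆ w : Metric.closedBall (0 : H) Λ, ∑ k, a k * ℓ ⟪(w : H), φ (p k)⟫ := by
  have : Nonempty (Metric.closedBall (0 : H) Λ) := ⟨⟨0, by simpa⟩⟩
  let comb (p : ι → Z) (β : ι → ℝ) : H := ∑ l, β l • φ (p l)
  -- This maps into the ball and fixes its points. For `Λ = 0` it is identically zero; otherwise the
  -- denominator is positive, whence the case splits below.
  let clip (v : H) : H := (Λ / max Λ ‖v‖) • v
  let val (p : ι → Z) (v : H) : ℝ := ∑ k, a k * ℓ ⟪v, φ (p k)⟫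
  have hclip (v : H) : clip v ∈ Metric.closedBall (0 : H) Λ := by
    rw [mem_closedBall_zero_iff, norm_smul, Real.norm_of_nonneg (by positivity), div_mul_eq_mul_div]
    exact div_le_of_le_mul₀ (by positivity) hΛ (by gcongr; exact le_max_right _ _)
  have hclip_eq (v : H) (hv : ‖v‖ ≤ Λ) : clip v = v := by
    rcases hΛ.eq_or_lt with h | h
    · rw [← h] at hv
      simp [clip, norm_le_zero_iff.1 hv]
    · simp [clip, max_eq_left hv, h.ne']
  have hbdd (p : ι → Z) :
      BddAbove (Set.range fun w : Metric.closedBall (0 : H) Λ => val p w) := by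
    refine ⟨∑ k, |a k| * B, ?_⟩
    rintro _ ⟨w, rfl⟩
    refine Finset.sum_le_sum fun k _ => ?_
    refine (le_abs_self _).trans ?_
    rw [abs_mul]
    gcongr
    refine hB _ ((abs_real_inner_le_norm _ _).trans ?_)
    gcongr
    · exact mem_closedBall_zero_iff.1 w.2
    · exact hr _
  have hcont (p : ι → Z) : Continuous fun β => val p (clip (comb p β)) := by
    have hcomb : Continuous (comb p) := by fun_prop
    have hc : Continuous fun β => clip (comb p β) := by
      rcases hΛ.eq_or_lt with h | h
      · simp only [clip, ← h, zero_div, zero_smul]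
        fun_prop
      · refine Continuous.smul (Continuous.div (by fun_prop) (by fun_prop) fun β => ?_) hcomb
        exact (lt_max_of_lt_left h).ne'
    exact continuous_finsetSum _ fun k _ =>
      continuous_const.mul (hℓ.comp (hc.inner continuous_const))
  -- The value sees `w` only through its inner products with finitely many features. Projecting onto
  -- their span keeps these and does not increase the norm, so clipping changes nothing.
  have hspan (p : ι → Z) (w : H) (hw : ‖w‖ ≤ Λ) : ∃ β, val p w = val p (clip (comb p β)) := by
    set K := Submodule.span ℝ (Set.range fun k => φ (p k))
    have : FiniteDimensional ℝ K := FiniteDimensional.span_of_finite ℝ (Set.finite_range _)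
    obtain ⟨β, hβ⟩ := (Submodule.mem_span_range_iff_exists_fun ℝ).1 (K.orthogonalProjectionOnto w).2
    refine ⟨β, ?_⟩
    have h1 : comb p β = K.orthogonalProjectionOnto w := hβ
    have h2 : ‖((K.orthogonalProjectionOnto w : K) : H)‖ ≤ Λ :=
      (K.norm_orthogonalProjectionOnto_apply_le w).trans hw
    rw [h1, hclip_eq _ h2]
    refine Finset.sum_congr rfl fun k _ => ?_
    have := K.starProjection_inner_eq_zero w (φ (p k)) (Submodule.subset_span ⟨k, rfl⟩)
    rw [inner_sub_left, sub_eq_zero] at this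
    exact congrArg (fun x => a k * ℓ x) this
  have heq (p : ι → Z) : (⨆ w : Metric.closedBall (0 : H) Λ, val p w)
      = ⨆ m : ℕ, val p (clip (comb p (TopologicalSpace.denseSeq (ι → ℝ) m))) := by
    have hle (β : ι → ℝ) : val p (clip (comb p β))
        ≤ ⨆ w : Metric.closedBall (0 : H) Λ, val p w := le_ciSup (hbdd p) ⟨_, hclip (comb p β)⟩
    refine le_antisymm (ciSup_le fun w => ?_) (ciSup_le fun m => hle _)
    obtain ⟨β, hβ⟩ := hspan p w (mem_closedBall_zero_iff.1 w.2)
    rw [hβ]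
    refine isClosed_property (TopologicalSpace.denseRange_denseSeq (ι → ℝ))
      (p := fun β => val p (clip (comb p β))
        ≤ ⨆ m : ℕ, val p (clip (comb p (TopologicalSpace.denseSeq (ι → ℝ) m))))
      (isClosed_le (hcont p) continuous_const) (fun m => ?_) β
    exact le_ciSup (f := fun m : ℕ => val p (clip (comb p (TopologicalSpace.denseSeq (ι → ℝ) m))))
      ⟨_, by rintro _ ⟨m, rfl⟩; exact hle _⟩ m
  change Measurable fun p : ι → Z => ⨆ w : Metric.closedBall (0 : H) Λ, val p w
  simp only [heq]
  refine Measurable.iSup fun m => ?_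
  set β := TopologicalSpace.denseSeq (ι → ℝ) m
  -- For fixed coefficients `β`, all inner products and norms are expressions in kernel values.
  have hker (l k : ι) : Measurable fun p : ι → Z => ⟪φ (p l), φ (p k)⟫ := by
    have hlk : Measurable fun p : ι → Z => (p l, p k) :=
      (measurable_pi_apply l).prodMk (measurable_pi_apply k)
    exact hφ.comp hlk
  have hin (k : ι) : Measurable fun p : ι → Z => ⟪comb p β, φ (p k)⟫ := by
    simp only [comb, sum_inner, real_inner_smul_left]
    exact Finset.measurable_fun_sum _ fun l _ => (hker l k).const_mul _
  have hnorm : Measurable fun p : ι → Z => ‖comb p β‖ := by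
    have : ∀ p, ‖comb p β‖ = √(∑ k, β k * ⟪comb p β, φ (p k)⟫) := by
      intro p
      rw [norm_eq_sqrt_real_inner]
      conv_lhs => enter [1, 3]; simp only [comb]
      simp only [inner_sum, real_inner_smul_right]
    simp only [this]
    exact (Finset.measurable_fun_sum _ fun k _ => (hin k).const_mul _).sqrt
  refine Finset.measurable_fun_sum _ fun k _ => Measurable.const_mul (hℓ.measurable.comp ?_) _
  simp only [clip, real_inner_smul_left]
  exact (measurable_const.div (measurable_const.max hnorm)).mul (hin k)

theorem measurable_sampleDeviation (hφ : Measurable fun p : Z × Z => ⟪φ p.1, φ p.2⟫)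
    (hΛ : 0 ≤ Λ) (hr : ∀ z, ‖φ z‖ ≤ r) (hℓ : Continuous ℓ)
    (hB : ∀ u, |u| ≤ Λ * r → ℓ u ∈ Set.Icc 0 B) :
    Measurable fun p : (Fin n → Z) × (Fin n → Z) => sampleDeviation ℓ φ Λ p.1 p.2 := by
  have h := measurable_iSup_closedBall (ι := Fin n ⊕ Fin n) hφ hΛ hr hℓ (B := B)
    (fun u hu => by rw [abs_of_nonneg (hB u hu).1]; exact (hB u hu).2)
    (Sum.elim (fun _ => -1) fun _ => 1)
  have he : Measurable fun p : (Fin n → Z) × (Fin n → Z) => Sum.elim p.1 p.2 := by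
    refine measurable_pi_lambda _ fun k => ?_
    rcases k with i | i
    · exact (measurable_pi_apply i).comp measurable_fst
    · exact (measurable_pi_apply i).comp measurable_snd
  convert h.comp he using 2 with p
  simp only [sampleDeviation, Function.comp, Fintype.sum_sum_type, Sum.elim_inl, Sum.elim_inr,
    Finset.sum_sub_distrib, one_mul, neg_one_mul, Finset.sum_neg_distrib]
  refine iSup_congr fun w => ?_
  ring

/-! ### Symmetrization with a ghost sample. -/

theorem integral_sampleDeviation_le (D : Measure Z) [IsProbabilityMeasure D]
    (hφ : Measurable fun p : Z × Z => ⟪φ p.1, φ p.2⟫)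
    (hΛ : 0 ≤ Λ) (hr0 : 0 ≤ r) (hr : ∀ z, ‖φ z‖ ≤ r)
    {ρ : ℝ≥0} (hℓ : LipschitzWith ρ ℓ) (hB : ∀ u, |u| ≤ Λ * r → ℓ u ∈ Set.Icc 0 B) :
    ∫ S, ∫ S', sampleDeviation ℓ φ Λ S S' ∂(Measure.pi fun _ : Fin n => D)
      ∂(Measure.pi fun _ : Fin n => D) ≤ 2 * (ρ * Λ * r * √n) := by
  have hm := measurable_sampleDeviation (n := n) hφ hΛ hr hℓ.continuous hB
  have hbd := abs_sampleDeviation_le (n := n) hΛ hr hB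
  have hmp := measurePreserving_arrowProdEquivProdArrow Z Z (Fin n) (fun _ => D) (fun _ => D)
  have h1 : ∫ S, ∫ S', sampleDeviation ℓ φ Λ S S' ∂(Measure.pi fun _ : Fin n => D)
      ∂(Measure.pi fun _ : Fin n => D)
      = ∫ q : Fin n → Z × Z, sampleDeviation ℓ φ Λ (fun i => (q i).1) (fun i => (q i).2)
        ∂(Measure.pi fun _ => D.prod D) := by
    rw [← integral_prod (fun p : (Fin n → Z) × (Fin n → Z) => sampleDeviation ℓ φ Λ p.1 p.2)
      (Integrable.of_bound hm.aestronglyMeasurable (n * B) (ae_of_all _ fun p => hbd _ _)),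
      ← hmp.integral_comp']
    rfl
  have hmq : Measurable fun q : Fin n → Z × Z =>
      sampleDeviation ℓ φ Λ (fun i => (q i).1) (fun i => (q i).2) :=
    hm.comp (MeasurableEquiv.arrowProdEquivProdArrow Z Z (Fin n)).measurable
  have hsw (ε : Fin n → ℤˣ) : MeasurePreserving (fun (q : Fin n → Z × Z) i => swapBy (ε i) (q i))
      (Measure.pi fun _ => D.prod D) (Measure.pi fun _ => D.prod D) := by
    refine measurePreserving_pi _ _ fun i => ?_
    rcases Int.units_eq_one_or (ε i) with h | h
    · rw [h]
      exact MeasurePreserving.id _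
    · rw [h]
      exact Measure.measurePreserving_swap
  -- The law of the pairs is invariant under coordinatewise exchanges, so the integral equals its
  -- average over all `2 ^ n` sign vectors.
  have h2 (ε : Fin n → ℤˣ) : ∫ q : Fin n → Z × Z, sampleDeviation ℓ φ Λ
        (fun i => (swapBy (ε i) (q i)).1) (fun i => (swapBy (ε i) (q i)).2)
        ∂(Measure.pi fun _ => D.prod D)
      = ∫ q : Fin n → Z × Z, sampleDeviation ℓ φ Λ (fun i => (q i).1) (fun i => (q i).2)
        ∂(Measure.pi fun _ => D.prod D) := by
    conv_rhs => rw [← (hsw ε).map_eq]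
    rw [integral_map (hsw ε).measurable.aemeasurable hmq.aestronglyMeasurable]
  have h3 : ∑ ε : Fin n → ℤˣ, ∫ q : Fin n → Z × Z, sampleDeviation ℓ φ Λ
        (fun i => (swapBy (ε i) (q i)).1) (fun i => (swapBy (ε i) (q i)).2)
        ∂(Measure.pi fun _ => D.prod D) ≤ 2 ^ n * (2 * (ρ * Λ * r * √n)) := by
    have hi (ε : Fin n → ℤˣ) : Integrable (fun q : Fin n → Z × Z => sampleDeviation ℓ φ Λ
        (fun i => (swapBy (ε i) (q i)).1) (fun i => (swapBy (ε i) (q i)).2))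
        (Measure.pi fun _ => D.prod D) :=
      Integrable.of_bound (hmq.comp (hsw ε).measurable).aestronglyMeasurable (n * B)
        (ae_of_all _ fun q => hbd _ _)
    rw [← integral_finsetSum _ fun ε _ => hi ε]
    refine (integral_mono (integrable_finsetSum _ fun ε _ => hi ε) (integrable_const _)
      fun q => sum_signs_sampleDeviation_le hΛ hr0 hr hℓ hB q).trans ?_
    simp
  simp only [h2, Finset.sum_const, nsmul_eq_mul] at h3
  rw [h1]
  have hcard : (((Finset.univ : Finset (Fin n → ℤˣ)).card : ℕ) : ℝ) = 2 ^ n := by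
    simp [Finset.card_univ, Fintype.card_units_int]
  rw [hcard] at h3
  exact le_of_mul_le_mul_left h3 (by positivity)

/-- The left side is the ghost sample mean of the difference at `w`, which the supremum dominates.
It holds for every `S`, so randomness of `S` enters only through the right side. -/
theorem mul_integral_sub_sum_le_integral_sampleDeviation [CompleteSpace H] (D : Measure Z)
    [IsProbabilityMeasure D] (hφ : Measurable fun p : Z × Z => ⟪φ p.1, φ p.2⟫)
    (hΛ : 0 ≤ Λ) (hr : ∀ z, ‖φ z‖ ≤ r) (hℓ : Continuous ℓ)
    (hB : ∀ u, |u| ≤ Λ * r → ℓ u ∈ Set.Icc 0 B) (w : H) (hw : ‖w‖ ≤ Λ) (S : Fin n → Z) :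
    n * ∫ z, ℓ ⟪w, φ z⟫ ∂D - ∑ i, ℓ ⟪w, φ (S i)⟫
      ≤ ∫ S', sampleDeviation ℓ φ Λ S S' ∂(Measure.pi fun _ : Fin n => D) := by
  let w' : Metric.closedBall (0 : H) Λ := ⟨w, mem_closedBall_zero_iff.2 hw⟩
  have hgm : Measurable fun z => ℓ ⟪w, φ z⟫ :=
    hℓ.measurable.comp (measurable_inner_featureMap hφ w)
  have hgi : ∀ i : Fin n, Integrable (fun S' : Fin n → Z => ℓ ⟪w, φ (S' i)⟫)
      (Measure.pi fun _ : Fin n => D) := fun i =>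
    Integrable.of_bound (hgm.comp (measurable_pi_apply i)).aestronglyMeasurable B
      (ae_of_all _ fun S' => by
        have := loss_mem_Icc hr hB w' (S' i)
        rw [Real.norm_of_nonneg this.1]
        exact this.2)
  have hdi : ∀ i ∈ Finset.univ, Integrable
      (fun S' : Fin n → Z => ℓ ⟪w, φ (S' i)⟫ - ℓ ⟪w, φ (S i)⟫) (Measure.pi fun _ : Fin n => D) :=
    fun i _ => (hgi i).sub (integrable_const _)
  have hmean : ∫ S' : Fin n → Z, ∑ i, (ℓ ⟪w, φ (S' i)⟫ - ℓ ⟪w, φ (S i)⟫)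
      ∂(Measure.pi fun _ : Fin n => D) = n * ∫ z, ℓ ⟪w, φ z⟫ ∂D - ∑ i, ℓ ⟪w, φ (S i)⟫ := by
    have (i : Fin n) : ∫ S' : Fin n → Z, (ℓ ⟪w, φ (S' i)⟫ - ℓ ⟪w, φ (S i)⟫)
        ∂(Measure.pi fun _ : Fin n => D) = ∫ z, ℓ ⟪w, φ z⟫ ∂D - ℓ ⟪w, φ (S i)⟫ := by
      rw [integral_sub (hgi i) (integrable_const _),
        integral_comp_eval (μ := fun _ : Fin n => D) (f := fun z => ℓ ⟪w, φ z⟫)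
          hgm.aestronglyMeasurable]
      simp
    rw [integral_finsetSum _ hdi]
    simp [this]
  rw [← hmean]
  refine integral_mono (integrable_finsetSum _ hdi)
    (Integrable.of_bound ((measurable_sampleDeviation hφ hΛ hr hℓ hB).comp
      (measurable_const.prodMk measurable_id)).aestronglyMeasurable (n * B)
      (ae_of_all _ fun S' => abs_sampleDeviation_le hΛ hr hB S S')) fun S' => ?_
  exact le_ciSup (bddAbove_sum_loss_sub_loss hr hB S S') w'

end FeatureMap

/-! ### Comparison and integrability of the losses. -/

theorem natCast_mul_hammingLoss {c : ℕ} (h y : Labels c) :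
    (c : ℝ) * hammingLoss h y = ∑ j, if h j ≠ y j then (1 : ℝ) else 0 := by
  rcases Nat.eq_zero_or_pos c with rfl | hc
  · simp
  · rw [hammingLoss, ← mul_assoc, mul_one_div_cancel (by positivity), one_mul]

theorem natCast_mul_hammingSurrogate {c : ℕ} (ℓ : ℝ → ℝ) (v : Fin c → ℝ) (y : Labels c) :
    (c : ℝ) * hammingSurrogate ℓ v y = ∑ j, ℓ (((y j : ℤ) : ℝ) * v j) := by
  rcases Nat.eq_zero_or_pos c with rfl | hc
  · simp
  · rw [hammingSurrogate, ← mul_assoc, mul_one_div_cancel (by positivity), one_mul]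

theorem hammingLoss_nonneg {c : ℕ} (h y : Labels c) : 0 ≤ hammingLoss h y :=
  mul_nonneg (by positivity) (Finset.sum_nonneg fun j _ => by split_ifs <;> norm_num)

theorem hammingLoss_le_one {c : ℕ} (h y : Labels c) : hammingLoss h y ≤ 1 := by
  have h1 : (∑ j, if h j ≠ y j then (1 : ℝ) else 0) ≤ c := by
    refine (Finset.sum_le_sum (g := fun _ => (1 : ℝ)) fun j _ => ?_).trans (by simp)
    split_ifs <;> norm_num
  refine (mul_le_mul_of_nonneg_left h1 (by positivity)).trans ?_
  rw [one_div_mul_eq_div]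
  exact div_self_le_one _

theorem rankingLoss_nonneg {c : ℕ} (v : Fin c → ℝ) (y : Labels c) : 0 ≤ rankingLoss v y :=
  mul_nonneg (by positivity) (Finset.sum_nonneg fun p _ => Finset.sum_nonneg fun q _ => by
    split_ifs <;> norm_num)

/-- A misranked pair contains a misclassified label. -/
theorem rankingLoss_le_natCast_mul_hammingLoss {c : ℕ} (v : Fin c → ℝ) (y : Labels c) :
    rankingLoss v y ≤ c * hammingLoss (sgnVec v) y := by
  rw [natCast_mul_hammingLoss]
  set e : Fin c → ℝ := fun j => if sgnVec v j ≠ y j then (1 : ℝ) else 0 with he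
  have he0 (j) : 0 ≤ e j := by simp only [he]; split_ifs <;> norm_num
  have hpq : ∀ p ∈ relevant y, ∀ q ∈ irrelevant y,
      (if v p ≤ v q then (1 : ℝ) else 0) ≤ e p + e q := by
    intro p hp q hq
    simp only [relevant, irrelevant, Finset.mem_filter, Finset.mem_univ, true_and] at hp hq
    split_ifs with h
    -- If `v p` is positive, so is `v q` and `q` is misclassified; otherwise `p` is, also at `v p =
    -- 0` because `sgn 0 = -1`.
    · by_cases hvp : 0 < v p
      · have : e q = 1 := by simp [he, sgnVec, sgn, hq, hvp.trans_le h]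
        linarith [he0 p]
      · have : e p = 1 := by
          simp only [he, sgnVec, sgn, hp, hvp]
          simp
        linarith [he0 q]
    · exact add_nonneg (he0 p) (he0 q)
  have hX : 0 ≤ ∑ p ∈ relevant y, e p := Finset.sum_nonneg fun p _ => he0 p
  have hY : 0 ≤ ∑ q ∈ irrelevant y, e q := Finset.sum_nonneg fun q _ => he0 q
  have hXY : ∑ p ∈ relevant y, e p + ∑ q ∈ irrelevant y, e q ≤ ∑ j, e j := by
    rw [relevant, irrelevant, Finset.sum_filter, Finset.sum_filter, ← Finset.sum_add_distrib]
    refine Finset.sum_le_sum fun j _ => ?_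
    rcases Int.units_eq_one_or (y j) with h | h <;> simp [h]
  refine le_trans ?_ hXY
  -- Each `e p` is counted once per irrelevant label and each `e q` once per relevant one. After
  -- normalization the weights are the inverse cardinalities, at most `1`.
  have hsum : ∑ p ∈ relevant y, ∑ q ∈ irrelevant y, (if v p ≤ v q then (1 : ℝ) else 0)
      ≤ (irrelevant y).card * ∑ p ∈ relevant y, e p
        + (relevant y).card * ∑ q ∈ irrelevant y, e q := by
    refine (Finset.sum_le_sum fun p hp => Finset.sum_le_sum fun q hq => hpq p hp q hq).trans ?_
    simp [Finset.sum_add_distrib, Finset.mul_sum]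
  unfold rankingLoss
  rcases Nat.eq_zero_or_pos (relevant y).card with ha | ha
  · simpa [ha] using add_nonneg hX hY
  rcases Nat.eq_zero_or_pos (irrelevant y).card with hb | hb
  · simpa [hb] using add_nonneg hX hY
  have ha' : (1 : ℝ) ≤ (relevant y).card := by exact_mod_cast ha
  have hb' : (1 : ℝ) ≤ (irrelevant y).card := by exact_mod_cast hb
  rw [one_div_mul_eq_div, div_le_iff₀ (by positivity)]
  refine hsum.trans ?_
  have h1 := mul_le_mul_of_nonneg_left ha'
    (mul_nonneg (by positivity : (0 : ℝ) ≤ (irrelevant y).card) hX)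
  have h2 := mul_le_mul_of_nonneg_left hb'
    (mul_nonneg (by positivity : (0 : ℝ) ≤ (relevant y).card) hY)
  linarith

/-- The σ-algebra on the units is pulled back from `ℤ`. Discreteness of the labels allows
measurability of a loss to be checked with `y` fixed. -/
instance : MeasurableSingletonClass ℤˣ where
  measurableSet_singleton u := ⟨{(u : ℤ)}, measurableSet_singleton _, by ext; simp [Units.ext_iff]⟩

theorem measurable_sgn : Measurable sgn :=
  Measurable.ite measurableSet_Ioi measurable_const measurable_const

section Losses

variable {𝒳 : Type*} [MeasurableSpace 𝒳] {c : ℕ} {f : 𝒳 → Fin c → ℝ}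

theorem measurable_rankingLoss (hf : ∀ j, Measurable fun x => f x j) :
    Measurable fun z : 𝒳 × Labels c => rankingLoss (f z.1) z.2 := by
  refine measurable_from_prod_countable_left fun y => ?_
  simp only [rankingLoss]
  exact Measurable.const_mul (Finset.measurable_fun_sum _ fun p _ =>
    Finset.measurable_fun_sum _ fun q _ =>
      Measurable.ite (measurableSet_le (hf p) (hf q)) measurable_const measurable_const) _

theorem measurable_hammingLoss (hf : ∀ j, Measurable fun x => f x j) :
    Measurable fun z : 𝒳 × Labels c => hammingLoss (sgnVec (f z.1)) z.2 := by
  refine measurable_from_prod_countable_left fun y => ?_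
  simp only [hammingLoss]
  refine Measurable.const_mul (Finset.measurable_fun_sum _ fun j _ =>
    Measurable.ite ?_ measurable_const measurable_const) _
  exact ((measurable_sgn.comp (hf j)) (measurableSet_singleton (y j))).compl

variable (D : Measure (𝒳 × Labels c)) [IsProbabilityMeasure D]

theorem integrable_hammingLoss (hf : ∀ j, Measurable fun x => f x j) :
    Integrable (fun z => hammingLoss (sgnVec (f z.1)) z.2) D :=
  Integrable.of_bound (measurable_hammingLoss hf).aestronglyMeasurable 1
    (ae_of_all _ fun z => by
      rw [Real.norm_of_nonneg (hammingLoss_nonneg _ _)]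
      exact hammingLoss_le_one _ _)

theorem integrable_rankingLoss (hf : ∀ j, Measurable fun x => f x j) :
    Integrable (fun z => rankingLoss (f z.1) z.2) D :=
  Integrable.of_bound (measurable_rankingLoss hf).aestronglyMeasurable c
    (ae_of_all _ fun z => by
      rw [Real.norm_of_nonneg (rankingLoss_nonneg _ _)]
      refine (rankingLoss_le_natCast_mul_hammingLoss _ _).trans ?_
      exact mul_le_of_le_one_right (by positivity) (hammingLoss_le_one _ _))

theorem risk_rankingLoss_le (hf : ∀ j, Measurable fun x => f x j) :
    risk D rankingLoss f ≤ c * risk D hammingLoss (fun x => sgnVec (f x)) := by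
  unfold risk
  rw [← integral_const_mul]
  exact integral_mono (integrable_rankingLoss D hf) ((integrable_hammingLoss D hf).const_mul _)
    fun z => rankingLoss_le_natCast_mul_hammingLoss _ _

end Losses

/-! ### Reduction of the multi-label problem to scalar ones. -/

section LabelFeature

variable {𝒳 : Type*} {H : Type*} [NormedAddCommGroup H] [InnerProductSpace ℝ H] {c : ℕ}

/-- The feature map with the `j`-th label as a sign. -/
def labelFeature (φ : 𝒳 → H) (j : Fin c) (z : 𝒳 × Labels c) : H := ((z.2 j : ℤ) : ℝ) • φ z.1

/-- This turns the surrogate for label `j` into `ℓ` of a linear functional, while the feature norm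
stays bounded by `r`. -/
theorem inner_labelFeature (φ : 𝒳 → H) (j : Fin c) (w : H) (z : 𝒳 × Labels c) :
    ⟪w, labelFeature φ j z⟫ = ((z.2 j : ℤ) : ℝ) * ⟪w, φ z.1⟫ :=
  real_inner_smul_right _ _ _

theorem norm_labelFeature (φ : 𝒳 → H) (j : Fin c) (z : 𝒳 × Labels c) :
    ‖labelFeature φ j z‖ = ‖φ z.1‖ := by
  rcases Int.units_eq_one_or (z.2 j) with h | h <;> simp [labelFeature, h]

theorem IsFeatureMap.norm_le {κ : 𝒳 → 𝒳 → ℝ} {φ : 𝒳 → H} (hφ : IsFeatureMap κ φ) {r : ℝ}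
    (hr : 0 ≤ r) (hκ : ∀ x, κ x x ≤ r ^ 2) (x : 𝒳) : ‖φ x‖ ≤ r := by
  have h := hκ x
  rw [hφ x x, real_inner_self_eq_norm_sq] at h
  exact abs_le_of_sq_le_sq' h hr |>.2

variable [MeasurableSpace 𝒳]

theorem IsFeatureMap.measurable_inner {κ : 𝒳 → 𝒳 → ℝ} {φ : 𝒳 → H} (hφ : IsFeatureMap κ φ)
    (hκ : Measurable (Function.uncurry κ)) : Measurable fun p : 𝒳 × 𝒳 => ⟪φ p.1, φ p.2⟫ := by
  convert hκ using 2 with p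
  exact (hφ _ _).symm

theorem measurable_inner_labelFeature {φ : 𝒳 → H}
    (hφ : Measurable fun p : 𝒳 × 𝒳 => ⟪φ p.1, φ p.2⟫) (j : Fin c) :
    Measurable fun p : (𝒳 × Labels c) × (𝒳 × Labels c) =>
      ⟪labelFeature φ j p.1, labelFeature φ j p.2⟫ := by
  have hy : Measurable fun z : 𝒳 × Labels c => ((z.2 j : ℤ) : ℝ) :=
    (measurable_of_countable fun u : ℤˣ => ((u : ℤ) : ℝ)).comp
      ((measurable_pi_apply j).comp measurable_snd)
  have hx : Measurable fun p : (𝒳 × Labels c) × (𝒳 × Labels c) => ⟪φ p.1.1, φ p.2.1⟫ :=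
    hφ.comp ((measurable_fst.comp measurable_fst).prodMk (measurable_fst.comp measurable_snd))
  simp only [labelFeature, real_inner_smul_left, real_inner_smul_right]
  exact (hy.comp measurable_snd).mul ((hy.comp measurable_fst).mul hx)

/-- The sum over the labels of the expected deviations between a given and a fresh sample. -/
noncomputable def totalDeviation (D : Measure (𝒳 × Labels c)) (ℓ : ℝ → ℝ) (φ : 𝒳 → H) (Λ : ℝ)
    {n : ℕ} (S : Fin n → 𝒳 × Labels c) : ℝ :=
  ∑ j, ∫ S', sampleDeviation ℓ (labelFeature φ j) Λ S S' ∂(Measure.pi fun _ : Fin n => D)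

variable (D : Measure (𝒳 × Labels c)) [IsProbabilityMeasure D] {ℓ : ℝ → ℝ} {φ : 𝒳 → H}
  {Λ r B : ℝ} {n : ℕ}

theorem measurable_integral_sampleDeviation
    (hφ : Measurable fun p : 𝒳 × 𝒳 => ⟪φ p.1, φ p.2⟫) (hΛ : 0 ≤ Λ) (hr : ∀ x, ‖φ x‖ ≤ r)
    (hℓ : Continuous ℓ) (hB : ∀ u, |u| ≤ Λ * r → ℓ u ∈ Set.Icc 0 B) (j : Fin c) :
    Measurable fun S : Fin n → 𝒳 × Labels c => ∫ S', sampleDeviation ℓ (labelFeature φ j) Λ S S'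
      ∂(Measure.pi fun _ : Fin n => D) :=
  (measurable_sampleDeviation (measurable_inner_labelFeature hφ j) hΛ
    (fun z => (norm_labelFeature φ j z).trans_le (hr _)) hℓ
    hB).stronglyMeasurable.integral_prod_right.measurable

theorem abs_totalDeviation_le (hΛ : 0 ≤ Λ) (hr : ∀ x, ‖φ x‖ ≤ r)
    (hB : ∀ u, |u| ≤ Λ * r → ℓ u ∈ Set.Icc 0 B) (S : Fin n → 𝒳 × Labels c) :
    |totalDeviation D ℓ φ Λ S| ≤ c * (n * B) := by
  refine (Finset.abs_sum_le_sum_abs _ _).trans ?_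
  refine (Finset.sum_le_sum (g := fun _ => n * B) fun j _ => ?_).trans (by simp)
  exact abs_integral_le_of_forall _ fun S' => abs_sampleDeviation_le hΛ
    (fun z => (norm_labelFeature φ j z).trans_le (hr _)) hB S S'

/-- One sample point enters the deviations of all `c` labels, each by at most `B`. -/
theorem abs_totalDeviation_update_sub_le (hφ : Measurable fun p : 𝒳 × 𝒳 => ⟪φ p.1, φ p.2⟫)
    (hΛ : 0 ≤ Λ) (hr : ∀ x, ‖φ x‖ ≤ r) (hℓ : Continuous ℓ)
    (hB : ∀ u, |u| ≤ Λ * r → ℓ u ∈ Set.Icc 0 B) (S : Fin n → 𝒳 × Labels c) (i : Fin n)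
    (z : 𝒳 × Labels c) :
    |totalDeviation D ℓ φ Λ (Function.update S i z) - totalDeviation D ℓ φ Λ S| ≤ c * B := by
  unfold totalDeviation
  rw [← Finset.sum_sub_distrib]
  refine (Finset.abs_sum_le_sum_abs _ _).trans ?_
  refine (Finset.sum_le_sum (g := fun _ => B) fun j _ => ?_).trans (by simp)
  have hr' := fun z => (norm_labelFeature φ j z).trans_le (hr z.1)
  have hi (T : Fin n → 𝒳 × Labels c) : Integrable
      (fun S' => sampleDeviation ℓ (labelFeature φ j) Λ T S') (Measure.pi fun _ : Fin n => D) :=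
    Integrable.of_bound ((measurable_sampleDeviation (measurable_inner_labelFeature hφ j) hΛ hr'
      hℓ hB).comp (measurable_const.prodMk measurable_id)).aestronglyMeasurable (n * B)
      (ae_of_all _ fun S' => abs_sampleDeviation_le hΛ hr' hB T S')
  rw [← integral_sub (hi _) (hi _)]
  exact abs_integral_le_of_forall _ fun S' =>
    abs_sampleDeviation_update_sub_le hΛ hr' hB S S' i z

theorem integral_totalDeviation_le (hφ : Measurable fun p : 𝒳 × 𝒳 => ⟪φ p.1, φ p.2⟫)
    (hΛ : 0 ≤ Λ) (hr0 : 0 ≤ r) (hr : ∀ x, ‖φ x‖ ≤ r) {ρ : ℝ≥0} (hℓ : LipschitzWith ρ ℓ)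
    (hB : ∀ u, |u| ≤ Λ * r → ℓ u ∈ Set.Icc 0 B) :
    ∫ S, totalDeviation D ℓ φ Λ S ∂(Measure.pi fun _ : Fin n => D)
      ≤ c * (2 * (ρ * Λ * r * √n)) := by
  unfold totalDeviation
  have hr' (j : Fin c) := fun z => (norm_labelFeature φ j z).trans_le (hr z.1)
  rw [integral_finsetSum _ fun j _ => Integrable.of_bound
    (measurable_integral_sampleDeviation D hφ hΛ hr hℓ.continuous hB j).aestronglyMeasurable
    (n * B) (ae_of_all _ fun S => abs_integral_le_of_forall _ fun S' =>
      abs_sampleDeviation_le hΛ (hr' j) hB S S')]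
  refine (Finset.sum_le_sum (g := fun _ => 2 * (ρ * Λ * r * √n)) fun j _ => ?_).trans (by simp)
  exact integral_sampleDeviation_le D (measurable_inner_labelFeature hφ j) hΛ hr0 (hr' j) hℓ hB

variable [CompleteSpace H]

/-- The total deviation controls the generalization gap uniformly over the hypotheses. -/
theorem natCast_mul_risk_hammingLoss_le (hφ : Measurable fun p : 𝒳 × 𝒳 => ⟪φ p.1, φ p.2⟫)
    (hΛ : 0 ≤ Λ) (hr : ∀ x, ‖φ x‖ ≤ r) (hℓ : Continuous ℓ)
    (hB : ∀ u, |u| ≤ Λ * r → ℓ u ∈ Set.Icc 0 B)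
    (hdom : ∀ (v : ℝ) (y : ℤˣ), (if sgn v ≠ y then (1 : ℝ) else 0) ≤ ℓ (((y : ℤ) : ℝ) * v))
    (hn : 0 < n) (S : Fin n → 𝒳 × Labels c) (w : Fin c → H) (hw : ∀ j, ‖w j‖ ≤ Λ) :
    c * risk D hammingLoss (fun x => sgnVec fun j => ⟪w j, φ x⟫)
      ≤ c * empiricalRisk S (hammingSurrogate ℓ) (fun x j => ⟪w j, φ x⟫)
        + totalDeviation D ℓ φ Λ S / n := by
  have hr' (j : Fin c) := fun z => (norm_labelFeature φ j z).trans_le (hr z.1)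
  have hf (j : Fin c) : Measurable fun x => ⟪w j, φ x⟫ := measurable_inner_featureMap hφ _
  have hi : ∀ j ∈ Finset.univ, Integrable (fun z => ℓ ⟪w j, labelFeature φ j z⟫) D := fun j _ =>
    Integrable.of_bound (hℓ.measurable.comp (measurable_inner_featureMap
      (measurable_inner_labelFeature hφ j) (w j))).aestronglyMeasurable B
      (ae_of_all _ fun z => by
        have := loss_mem_Icc (hr' j) hB ⟨w j, mem_closedBall_zero_iff.2 (hw j)⟩ z
        rw [Real.norm_of_nonneg this.1]
        exact this.2)
  have h1 : c * risk D hammingLoss (fun x => sgnVec fun j => ⟪w j, φ x⟫)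
      ≤ ∑ j, ∫ z, ℓ ⟪w j, labelFeature φ j z⟫ ∂D := by
    unfold risk
    rw [← integral_const_mul, ← integral_finsetSum _ hi]
    refine integral_mono ((integrable_hammingLoss D hf).const_mul _)
      (integrable_finsetSum _ hi) fun z => ?_
    simp only
    rw [natCast_mul_hammingLoss]
    refine Finset.sum_le_sum fun j _ => ?_
    rw [inner_labelFeature]
    exact hdom _ _
  have h2 : c * empiricalRisk S (hammingSurrogate ℓ) (fun x j => ⟪w j, φ x⟫)
      = (∑ j, ∑ i, ℓ ⟪w j, labelFeature φ j (S i)⟫) / n := by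
    rw [empiricalRisk, mul_left_comm, Finset.mul_sum, one_div_mul_eq_div, Finset.sum_comm]
    simp only [natCast_mul_hammingSurrogate, inner_labelFeature]
  rw [h2, ← add_div]
  refine h1.trans ?_
  rw [le_div_iff₀ (by positivity), totalDeviation, ← Finset.sum_add_distrib, Finset.sum_mul]
  refine Finset.sum_le_sum fun j _ => ?_
  have := mul_integral_sub_sum_le_integral_sampleDeviation D (measurable_inner_labelFeature hφ j)
    hΛ (hr' j) hℓ hB (w j) (hw j) S
  linarith

end LabelFeature

end MultiLabel

/-! ### The main bound. -/

/-- The conclusion consists of the well-definedness of the two expected risks, and of the bound.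
"With probability at least `1 - δ` over `S ∼ D^n`" is expressed by saying that the set of samples
violating the bound for some `f` in the hypothesis set has (outer) measure at most `δ`. -/
theorem theorem5 {𝒳 : Type*} [MeasurableSpace 𝒳] {H : Type*} [NormedAddCommGroup H]
    [InnerProductSpace ℝ H] [CompleteSpace H] (c n : ℕ) (hn : 0 < n)
    (D : Measure (𝒳 × MultiLabel.Labels c)) [IsProbabilityMeasure D]
    (κ : 𝒳 → 𝒳 → ℝ) (hκ : Measurable (Function.uncurry κ))
    (φ : 𝒳 → H) (hφ : MultiLabel.IsFeatureMap κ φ)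
    (Λ r B : ℝ) (ρ : ℝ≥0) (hr : 0 < r) (hκr : ∀ x, κ x x ≤ r ^ 2)
    (ℓ : ℝ → ℝ) (hℓ_lip : LipschitzWith ρ ℓ)
    (hℓ_bdd : ∀ u, |u| ≤ Λ * r → |ℓ u| ≤ B)
    (hℓ_dom : ∀ (v : ℝ) (y : ℤˣ),
      (if MultiLabel.sgn v ≠ y then (1 : ℝ) else 0) ≤ ℓ (((y : ℤ) : ℝ) * v)) :
    (∀ f ∈ MultiLabel.hypotheses c φ Λ,
      Integrable (fun z => MultiLabel.rankingLoss (f z.1) z.2) D ∧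
      Integrable (fun z => MultiLabel.hammingLoss (MultiLabel.sgnVec (f z.1)) z.2) D) ∧
    ∀ δ : ℝ, 0 < δ →
      (Measure.pi fun _ : Fin n => D)
        {S | ¬ ∀ f ∈ MultiLabel.hypotheses c φ Λ,
          MultiLabel.risk D MultiLabel.rankingLoss f
              ≤ c * MultiLabel.risk D MultiLabel.hammingLoss (fun x => MultiLabel.sgnVec (f x)) ∧
          c * MultiLabel.risk D MultiLabel.hammingLoss (fun x => MultiLabel.sgnVec (f x))
              ≤ c * MultiLabel.empiricalRisk S (MultiLabel.hammingSurrogate ℓ) f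
                + 2 * √2 * ρ * c * √(Λ ^ 2 * r ^ 2 / n)
                + 3 * B * c * √(Real.log (2 / δ) / (2 * n))}
        ≤ ENNReal.ofReal δ := by
  have hφm := hφ.measurable_inner hκ
  have hφr := hφ.norm_le hr.le hκr
  have hmeas : ∀ f ∈ MultiLabel.hypotheses c φ Λ, ∀ j, Measurable fun x => f x j := by
    rintro f ⟨w, -, rfl⟩ j
    exact MultiLabel.measurable_inner_featureMap hφm (w j)
  refine ⟨fun f hf => ⟨MultiLabel.integrable_rankingLoss D (hmeas f hf),
    MultiLabel.integrable_hammingLoss D (hmeas f hf)⟩, fun δ hδ => ?_⟩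
  rcases lt_or_ge Λ 0 with hΛ | hΛ
  · have hempty (f) : f ∉ MultiLabel.hypotheses c φ Λ := by
      rintro ⟨w, hw, -⟩
      exact absurd hw (not_le.2 (hΛ.trans_le (Real.sqrt_nonneg _)))
    simp [hempty]
  -- This trivial case includes `δ > 2`, where the logarithm is negative and the square root takes
  -- the value `0`.
  rcases le_or_gt 1 δ with hδ1 | hδ1
  · exact prob_le_one.trans (by simpa using ENNReal.ofReal_le_ofReal hδ1)
  rcases Nat.eq_zero_or_pos c with rfl | hc
  · refine le_of_eq_of_le ?_ zero_le
    convert measure_empty (μ := Measure.pi fun _ : Fin n => D)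
    refine Set.eq_empty_of_forall_notMem fun S hS => hS fun f hf => ?_
    exact ⟨MultiLabel.risk_rankingLoss_le D (hmeas f hf), by simp⟩
  have hB : ∀ u, |u| ≤ Λ * r → ℓ u ∈ Set.Icc 0 B := by
    intro u hu
    refine ⟨?_, (le_abs_self _).trans (hℓ_bdd u hu)⟩
    have := hℓ_dom u 1
    simp only [Units.val_one, Int.cast_one, one_mul] at this
    exact le_trans (by split_ifs <;> norm_num) this
  -- Since `sgn 0 = -1`, the score `0` is an error for the label `1`, so `1 ≤ ℓ 0 ≤ B`.
  have hB1 : 1 ≤ B := by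
    have h1 := hℓ_dom 0 1
    have h2 := (hB 0 (by simpa using mul_nonneg hΛ hr.le)).2
    simp [MultiLabel.sgn] at h1
    linarith
  set L := -Real.log δ with hL
  have hL0 : 0 < L := neg_pos.2 (Real.log_neg hδ hδ1)
  -- Chosen so that the tail bound with differences `c * B` equals exactly `δ`.
  set ε := n * (2 * (c * B) * √(L / (2 * n))) with hε
  have hn' : (0 : ℝ) < n := by exact_mod_cast hn
  have hc' : (0 : ℝ) < c := by exact_mod_cast hc
  have hB0 : 0 < B := by linarith
  have hφc := hℓ_lip.continuous
  have hconc := MultiLabel.measureReal_ge_le_of_boundedDifferences D n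
    (MultiLabel.totalDeviation D ℓ φ Λ)
    (Finset.measurable_fun_sum _ fun j _ =>
      MultiLabel.measurable_integral_sampleDeviation D hφm hΛ hφr hφc hB j)
    (MultiLabel.abs_totalDeviation_le D hΛ hφr hB)
    (MultiLabel.abs_totalDeviation_update_sub_le D hφm hΛ hφr hφc hB)
    (ε := ε) (by positivity)
  have hexp : -ε ^ 2 / (2 * (n * (c * B) ^ 2)) = Real.log δ := by
    rw [hε, mul_pow, mul_pow _ (√_), Real.sq_sqrt (by positivity)]
    field_simp
    rw [hL]
    ring
  rw [hexp, Real.exp_log hδ] at hconc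
  have hmean := MultiLabel.integral_totalDeviation_le (n := n) D hφm hΛ hr.le hφr hℓ_lip hB
  refine (measure_mono ?_).trans
    ((ENNReal.le_ofReal_iff_toReal_le (measure_ne_top _ _) hδ.le).2 hconc)
  intro S hS
  by_contra hlt
  simp only [Set.mem_ofPred_eq, not_le] at hlt
  refine hS fun f hf => ⟨MultiLabel.risk_rankingLoss_le D (hmeas f hf), ?_⟩
  obtain ⟨w, hw, rfl⟩ := hf
  -- Only this weakening of the joint norm constraint is used.
  have hwj (j : Fin c) : ‖w j‖ ≤ Λ := by
    refine le_trans ?_ hw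
    refine Real.le_sqrt_of_sq_le ?_
    exact Finset.single_le_sum (f := fun j => ‖w j‖ ^ 2) (fun j _ => sq_nonneg _)
      (Finset.mem_univ j)
  refine (MultiLabel.natCast_mul_risk_hammingLoss_le D hφm hΛ hφr hφc hB hℓ_dom hn S w
    hwj).trans ?_
  rw [add_assoc]
  gcongr
  have hdiv : MultiLabel.totalDeviation D ℓ φ Λ S / n
      ≤ c * (2 * (ρ * Λ * r * √n)) / n + 2 * (c * B) * √(L / (2 * n)) := by
    rw [div_le_iff₀ hn', add_mul, div_mul_cancel₀ _ hn'.ne']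
    linarith
  -- The slack in the constants is spent here: `1 ≤ √2`, `2 ≤ 3` and `-log δ ≤ log (2 / δ)`.
  refine hdiv.trans (add_le_add ?_ ?_)
  · have h1 : √(Λ ^ 2 * r ^ 2 / n) = Λ * r * √n / n := by
      rw [← mul_pow, Real.sqrt_div (by positivity), Real.sqrt_sq (by positivity),
        mul_div_assoc (Λ * r) (√n), Real.sqrt_div_self, div_eq_mul_inv]
    rw [h1]
    have h2 : (1 : ℝ) ≤ √2 := Real.one_le_sqrt.2 one_le_two
    calc c * (2 * (ρ * Λ * r * √n)) / n = 2 * 1 * ρ * c * (Λ * r * √n / n) := by ring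
      _ ≤ _ := by gcongr
  · have h1 : L ≤ Real.log (2 / δ) := by
      rw [Real.log_div two_ne_zero hδ.ne', hL]
      linarith [Real.log_nonneg one_le_two]
    calc 2 * (c * B) * √(L / (2 * n)) ≤ 3 * (c * B) * √(Real.log (2 / δ) / (2 * n)) := by
          gcongr
          norm_num
      _ = _ := by ring
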